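/- **Setting.** Fix $\sigma>0$. In the two-armed Gaussian bandit with mean vector $\theta=(\theta_1,\theta_2)\in[0,1]^2$, in each round $t=1,\dots,T$ an arm $a_t\in\{1,2\}$ is pulled and a reward is observed which, conditionally on the past and on $a_t$, has law $\mathcal N(\theta_{a_t},\sigma^2)$. A fixed-time policy $\pi$ consists of one sub-policy $\pi(T)$ for every horizon $T$; $\pi(T)$ draws $a_t$ from a probability distribution on the arms that depends (measurably) on $t$ and on the previously pulled arms and observed rewards. Let $n_k$ be the number of pulls of arm $k$ in rounds $1,\dots,T$ under $\pi(T)$, and let $R_\theta^\pi(T)=\sum_{k=1}^{2} n_k\,(\max\{\theta_1,\theta_2\}-\theta_k)$ be the pseudo regret. Below, $\sup_\theta$ is over $\theta\in[0,1]^2$. **Theorem.** 1. There is a constant $C>0$ depending only on $\sigma$ such that the following holds. Let $\pi$ be a fixed-time policy with $$\limsup_{T\to\infty}\frac{\sup_\theta\mathbb E[R_\theta^\pi(T)]}{T}=0,$$ and let $(x(T))_{T\ge1}$ be real numbers, positive for all large $T$, with $$\limsup_{T\to\infty}\frac{x(T)}{T}<\frac12,\qquad \limsup_{T\to\infty}\frac{\sup_\theta\mathbb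 E[R_\theta^\pi(T)]}{x(T)}=0.$$ Then, for all large $T$, $\sup_\theta\mathbb E[R_\theta^\pi(T)]>0$ and $\sup_\theta\mathbb P(R_\theta^\pi(T)>x(T))>0$, and $$\liminf_{T\to\infty}\left\{\frac{\ln\left\{\sup_\theta\mathbb P\left(R_\theta^\pi(T)>x(T)\right)\right\}\cdot T}{x(T)\cdot\sup_\theta\mathbb E[R_\theta^\pi(T)]}\cdot\min\left\{1,\sqrt{\frac{x(T)\cdot\sup_\theta\mathbb E[R_\theta^\pi(T)]}{T\ln T}}\right\}\right\}\ge -C.$$ 2. Let $\theta,\tilde\theta\in[0,1]^2$ with $\theta_2>\theta_1=\tilde\theta_1>\tilde\theta_2$. There is a constant $C>0$ depending only on $\theta,\tilde\theta,\sigma$ such that the following holds. Let $\pi$ be a fixed-time policy with $$\limsup_{T\to\infty}\frac{\mathbb E[R_\vartheta^\pi(T)]}{T}=0\quad\text{for every }\vartheta\in[0,1]^2,$$ and let $(x(T))_{T\ge1}$ be real numbers with $\limsup_{T\to\infty}x(T)/T<\theta_2-\theta_1$. Then, for all large $T$, $\mathbb E[R_{\tilde\theta}^\pi(T)]>0$ and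 $\mathbb P(R_\theta^\pi(T)>x(T))>0$, and $$\liminf_{T\to\infty}\frac{\ln\left\{\mathbb P\left(R_\theta^\pi(T)>x(T)\right)\right\}}{\mathbb E[R_{\tilde\theta}^\pi(T)]}\ge -C.$$ -/

import Mathlib

open MeasureTheory ProbabilityTheory Filter
open scoped NNReal

namespace Bandit

/-- The histories of `t` completed rounds: in each round an arm and the reward observed. -/
abbrev History (K t : ℕ) : Type := Fin t → Fin K × ℝ

/-- A (randomized) policy: given the history of the first `t` rounds, a probability distribution
on the arms from which the next arm is drawn, measurably in the history. -/
structure Policy (K : ℕ) where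
  select : (t : ℕ) → Kernel (History K t) (Fin K)
  isMarkov : ∀ t, IsMarkovKernel (select t)

attribute [instance] Policy.isMarkov

/-- A fixed-time policy: for every horizon `T` a sub-policy, run during rounds `1, …, T` (what the
sub-policy for horizon `T` would do after round `T` is never used). -/
abbrev FixedTimePolicy (K : ℕ) : Type := ℕ → Policy K

/-- The reward of arm `a` has law `N(θ a, σ ^ 2)`. -/
noncomputable def rewardKernel {K : ℕ} (σ : ℝ≥0) (θ : Fin K → ℝ) : Kernel (Fin K) ℝ :=
  Kernel.ofFunOfCountable fun a => gaussianReal (θ a) (σ ^ 2)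

/-- One round after `t` completed ones: the arm is drawn by the policy from the history; given the
history and the arm, the reward is Gaussian with mean that of the arm and variance `σ ^ 2`. -/
noncomputable def roundKernel {K : ℕ} (σ : ℝ≥0) (p : Policy K) (θ : Fin K → ℝ) (t : ℕ) :
    Kernel (History K t) (Fin K × ℝ) :=
  p.select t ⊗ₖ Kernel.prodMkLeft (History K t) (rewardKernel σ θ)

/-- The law of the history of the first `t` rounds, when the policy `p` is run with mean
vector `θ`. -/
noncomputable def historyLaw {K : ℕ} (σ : ℝ≥0) (p : Policy K) (θ : Fin K → ℝ) :
    (t : ℕ) → Measure (History K t)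
  | 0 => Measure.dirac Fin.elim0
  | t + 1 => (historyLaw σ p θ t ⊗ₘ roundKernel σ p θ t).map
      fun z => Fin.snoc (α := fun _ => Fin K × ℝ) z.1 z.2

/-- The number of pulls of arm `a` in a history. -/
def pulls {K t : ℕ} (h : History K t) (a : Fin K) : ℕ :=
  (Finset.univ.filter fun s => (h s).1 = a).card

/-- The gap of arm `a`: the largest mean minus the mean of `a`. -/
noncomputable def gap {K : ℕ} (θ : Fin K → ℝ) (a : Fin K) : ℝ := (⨆ b, θ b) - θ a

/-- The pseudo regret of a history under the mean vector `θ`. -/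
noncomputable def pseudoRegret {K t : ℕ} (θ : Fin K → ℝ) (h : History K t) : ℝ :=
  ∑ a, (pulls h a : ℝ) * gap θ a

/-- Expected pseudo regret of `π` under `θ` over the horizon `T`. -/
noncomputable def expectedRegret {K : ℕ} (σ : ℝ≥0) (π : FixedTimePolicy K) (θ : Fin K → ℝ)
    (T : ℕ) : ℝ :=
  ∫ h, pseudoRegret θ h ∂(historyLaw σ (π T) θ T)

/-- Probability that the pseudo regret of `π` under `θ` over the horizon `T` exceeds `x`. -/
noncomputable def regretTail {K : ℕ} (σ : ℝ≥0) (π : FixedTimePolicy K) (θ : Fin K → ℝ)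
    (T : ℕ) (x : ℝ) : ℝ :=
  (historyLaw σ (π T) θ T).real {h | x < pseudoRegret θ h}

/-- The environments: mean vectors in `[0, 1] ^ K`. -/
def means (K : ℕ) : Set (Fin K → ℝ) := {θ | ∀ a, 0 ≤ θ a ∧ θ a ≤ 1}

/-- Worst-case expected pseudo regret. -/
noncomputable def worstRegret {K : ℕ} (σ : ℝ≥0) (π : FixedTimePolicy K) (T : ℕ) : ℝ :=
  ⨆ θ : means K, expectedRegret σ π θ T

/-- Worst-case probability that the pseudo regret exceeds `x`. -/
noncomputable def worstTail {K : ℕ} (σ : ℝ≥0) (π : FixedTimePolicy K) (T : ℕ) (x : ℝ) : ℝ :=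
  ⨆ θ : means K, regretTail σ π θ T x

/-! The laws above are probability measures, the pseudo regret is integrable, and both suprema are
over bounded sets, so no default value is hidden in these definitions. -/

instance {K : ℕ} (σ : ℝ≥0) (θ : Fin K → ℝ) : IsMarkovKernel (rewardKernel σ θ) :=
  ⟨fun a => by
    change IsProbabilityMeasure (gaussianReal (θ a) (σ ^ 2))
    infer_instance⟩

instance {K : ℕ} (σ : ℝ≥0) (p : Policy K) (θ : Fin K → ℝ) (t : ℕ) :
    IsMarkovKernel (roundKernel σ p θ t) := by
  unfold roundKernel
  infer_instance

theorem measurable_snoc {K t : ℕ} :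
    Measurable fun z : History K t × (Fin K × ℝ) =>
      (Fin.snoc (α := fun _ => Fin K × ℝ) z.1 z.2 : History K (t + 1)) := by
  refine measurable_pi_lambda _ fun i => ?_
  refine Fin.lastCases ?_ (fun j => ?_) i
  · simpa using measurable_snd
  · simpa using (show Measurable fun c : History K t × (Fin K × ℝ) => c.1 j from
      (measurable_pi_apply j).comp measurable_fst)

instance isProbabilityMeasure_historyLaw {K : ℕ} (σ : ℝ≥0) (p : Policy K) (θ : Fin K → ℝ)
    (t : ℕ) : IsProbabilityMeasure (historyLaw σ p θ t) := by
  induction t with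
  | zero => unfold historyLaw; infer_instance
  | succ t ih =>
    unfold historyLaw
    exact Measure.isProbabilityMeasure_map measurable_snoc.aemeasurable

theorem measurable_pseudoRegret {K t : ℕ} (θ : Fin K → ℝ) :
    Measurable (pseudoRegret θ : History K t → ℝ) := by
  have h : (pseudoRegret θ : History K t → ℝ) =
      fun h => ∑ a, (∑ s, if (h s).1 = a then (1 : ℝ) else 0) * gap θ a := by
    funext h
    simp [pseudoRegret, pulls]
  rw [h]
  refine Finset.measurable_sum _ fun a _ => Measurable.mul_const ?_ _
  refine Finset.measurable_sum _ fun s _ => ?_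
  exact Measurable.ite (measurableSet_eq_fun (measurable_fst.comp (measurable_pi_apply s))
    measurable_const) measurable_const measurable_const

theorem sum_pulls {K t : ℕ} (h : History K t) : ∑ a, pulls h a = t := by
  have := Finset.card_eq_sum_card_fiberwise (s := (Finset.univ : Finset (Fin t)))
    (t := (Finset.univ : Finset (Fin K))) (f := fun s => (h s).1) (by simp)
  simpa [pulls] using this.symm

theorem gap_nonneg {K : ℕ} (θ : Fin K → ℝ) (a : Fin K) : 0 ≤ gap θ a :=
  sub_nonneg.2 (le_ciSup (Set.finite_range θ).bddAbove a)

theorem gap_le_one {K : ℕ} {θ : Fin K → ℝ} (hθ : θ ∈ means K) (a : Fin K) : gap θ a ≤ 1 := by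
  have : Nonempty (Fin K) := ⟨a⟩
  have h1 : (⨆ b, θ b) ≤ 1 := ciSup_le fun b => (hθ b).2
  have h2 := (hθ a).1
  unfold gap
  linarith

theorem pseudoRegret_nonneg {K t : ℕ} (θ : Fin K → ℝ) (h : History K t) :
    0 ≤ pseudoRegret θ h :=
  Finset.sum_nonneg fun a _ => mul_nonneg (Nat.cast_nonneg _) (gap_nonneg θ a)

theorem pseudoRegret_le {K t : ℕ} {θ : Fin K → ℝ} (hθ : θ ∈ means K) (h : History K t) :
    pseudoRegret θ h ≤ t := by
  calc pseudoRegret θ h ≤ ∑ a, (pulls h a : ℝ) :=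
        Finset.sum_le_sum fun a _ =>
          mul_le_of_le_one_right (Nat.cast_nonneg _) (gap_le_one hθ a)
    _ = t := by exact_mod_cast sum_pulls h

theorem integrable_pseudoRegret {K : ℕ} (σ : ℝ≥0) (p : Policy K) {θ : Fin K → ℝ}
    (hθ : θ ∈ means K) (t : ℕ) :
    Integrable (fun h : History K t => pseudoRegret θ h) (historyLaw σ p θ t) :=
  Integrable.of_bound (measurable_pseudoRegret θ).aestronglyMeasurable (t : ℝ)
    (Eventually.of_forall fun h => by
      rw [Real.norm_of_nonneg (pseudoRegret_nonneg θ h)]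
      exact pseudoRegret_le hθ h)

theorem bddAbove_expectedRegret {K : ℕ} (σ : ℝ≥0) (π : FixedTimePolicy K) (T : ℕ) :
    BddAbove (Set.range fun θ : means K => expectedRegret σ π θ T) := by
  refine ⟨T, ?_⟩
  rintro _ ⟨θ, rfl⟩
  have := integral_mono (integrable_pseudoRegret σ (π T) θ.2 T) (integrable_const (T : ℝ))
    fun h => pseudoRegret_le θ.2 h
  simpa [expectedRegret] using this

theorem bddAbove_regretTail {K : ℕ} (σ : ℝ≥0) (π : FixedTimePolicy K) (T : ℕ) (x : ℝ) :
    BddAbove (Set.range fun θ : means K => regretTail σ π θ T x) := by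
  refine ⟨1, ?_⟩
  rintro _ ⟨θ, rfl⟩
  exact measureReal_le_one

end Bandit

namespace Bandit

/-! The argument is a change of measure. Arm 0 has the same mean under `θ` and `θ'`; arm 1 is better
than arm 0 under `θ` and worse under `θ'`. A policy with small regret under `θ'` rarely pulls arm 1
there, so with `θ'`-probability at least 1/2 it pulls arm 0 so often that the regret under `θ` would
exceed the level. The two history laws differ only through rewards of arm 1, so their relative
entropy is the expected number of pulls of arm 1 under `θ'` times a Gaussian constant, that is, a
multiple of the expected regret under `θ'`. An event of probability at least 1/2 under one law has
-log probability at most 2(entropy + log 2) under the other (`EntropyBound.tail`,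
`regretTail_lower_bound`).

The additive log 2 is removed by Markov's inequality: the tail is at most 1/16, which forces the
entropy to be at least log 2 (`neg_log_le_of_le_sixteenth`). This also yields positivity of the
regret. For the worst case, both gaps are taken proportional to x/T, so the entropy is of order x/T
times the worst regret. -/

/-- The variational bound of Donsker and Varadhan for bounded measurable functions: the relative
entropy of `μ` with respect to `ν` is at most `k`. -/
def EntropyBound {α : Type*} [MeasurableSpace α] (μ ν : Measure α) (k : ℝ) : Prop :=
  ∀ g : α → ℝ, Measurable g → (∃ M, ∀ x, |g x| ≤ M) →
    ∫ x, g x ∂μ ≤ k + Real.log (∫ x, Real.exp (g x) ∂ν)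

/-! ### Calculus of the variational entropy bound -/

section Entropy

variable {α β : Type*} [MeasurableSpace α] [MeasurableSpace β]

theorem integrable_of_abs_le {μ : Measure α} [IsFiniteMeasure μ] {g : α → ℝ} (hg : Measurable g)
    {M : ℝ} (hM : ∀ x, |g x| ≤ M) : Integrable g μ :=
  Integrable.of_bound hg.aestronglyMeasurable M (Eventually.of_forall hM)

theorem integrable_exp_of_abs_le {μ : Measure α} [IsFiniteMeasure μ] {g : α → ℝ}
    (hg : Measurable g) {M : ℝ} (hM : ∀ x, |g x| ≤ M) :
    Integrable (fun x => Real.exp (g x)) μ :=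
  integrable_of_abs_le (M := Real.exp M) hg.exp fun x => by
    rw [Real.abs_exp]
    exact Real.exp_le_exp.2 ((le_abs_self _).trans (hM x))

theorem integral_le_log_integral_exp {μ : Measure α} [IsProbabilityMeasure μ] {f : α → ℝ}
    (hf : Integrable f μ) (he : Integrable (fun x => Real.exp (f x)) μ) :
    ∫ x, f x ∂μ ≤ Real.log (∫ x, Real.exp (f x) ∂μ) := by
  set I := ∫ x, Real.exp (f x) ∂μ with hI
  have hpos : 0 < I := integral_exp_pos he
  have h1 : ∫ x, (f x - Real.log I) ∂μ ≤ ∫ x, (Real.exp (f x) * I⁻¹ - 1) ∂μ := by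
    refine integral_mono (hf.sub (integrable_const _))
      ((he.mul_const _).sub (integrable_const _)) fun x => ?_
    have := Real.add_one_le_exp (f x - Real.log I)
    rw [Real.exp_sub, Real.exp_log hpos, div_eq_mul_inv] at this
    change f x - Real.log I ≤ Real.exp (f x) * I⁻¹ - 1
    linarith
  rw [integral_sub hf (integrable_const _), integral_sub (he.mul_const _) (integrable_const _),
    integral_mul_const, ← hI, mul_inv_cancel₀ hpos.ne'] at h1
  simpa using h1

theorem entropyBound_refl (μ : Measure α) [IsProbabilityMeasure μ] : EntropyBound μ μ 0 := by
  rintro g hg ⟨M, hM⟩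
  rw [zero_add]
  exact integral_le_log_integral_exp (integrable_of_abs_le hg hM) (integrable_exp_of_abs_le hg hM)

theorem EntropyBound.map {μ ν : Measure α} {k : ℝ} (h : EntropyBound μ ν k) {f : α → β}
    (hf : Measurable f) : EntropyBound (μ.map f) (ν.map f) k := by
  rintro g hg ⟨M, hM⟩
  rw [integral_map hf.aemeasurable hg.aestronglyMeasurable,
    integral_map hf.aemeasurable hg.exp.aestronglyMeasurable]
  exact h (g ∘ f) (hg.comp hf) ⟨M, fun x => hM _⟩

theorem abs_log_integral_exp_le {μ : Measure α} [IsProbabilityMeasure μ] {g : α → ℝ}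
    (hg : Measurable g) {M : ℝ} (hM : ∀ x, |g x| ≤ M) :
    |Real.log (∫ x, Real.exp (g x) ∂μ)| ≤ M := by
  have he := integrable_exp_of_abs_le (μ := μ) hg hM
  have h1 : Real.exp (-M) ≤ ∫ x, Real.exp (g x) ∂μ := by
    simpa using integral_mono (integrable_const (Real.exp (-M))) he
      fun x => Real.exp_le_exp.2 (abs_le.1 (hM x)).1
  have h2 : ∫ x, Real.exp (g x) ∂μ ≤ Real.exp M := by
    simpa using integral_mono he (integrable_const (Real.exp M))
      fun x => Real.exp_le_exp.2 (abs_le.1 (hM x)).2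
  have hpos := (Real.exp_pos _).trans_le h1
  exact abs_le.2 ⟨(Real.le_log_iff_exp_le hpos).2 h1, (Real.log_le_iff_le_exp hpos).2 h2⟩

/-- Chain rule: the bound for `κ a` is applied in the second variable, and the resulting
log-partition function `G` then serves as test function for `μ` and `ν`. -/
theorem EntropyBound.compProd {μ ν : Measure α} [IsProbabilityMeasure μ] [IsProbabilityMeasure ν]
    {κ η : Kernel α β} [IsMarkovKernel κ] [IsMarkovKernel η] {k : ℝ} {d : α → ℝ}
    (h : EntropyBound μ ν k) (hd : Integrable d μ)
    (hκ : ∀ a, EntropyBound (κ a) (η a) (d a)) :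
    EntropyBound (μ ⊗ₘ κ) (ν ⊗ₘ η) (k + ∫ a, d a ∂μ) := by
  rintro g hg ⟨M, hM⟩
  have hga : ∀ a, Measurable fun b => g (a, b) := fun a => hg.comp measurable_prodMk_left
  have hgi : Integrable g (μ ⊗ₘ κ) := integrable_of_abs_le hg hM
  have hei : Integrable (fun x => Real.exp (g x)) (ν ⊗ₘ η) := integrable_exp_of_abs_le hg hM
  rw [Measure.integral_compProd hgi, Measure.integral_compProd hei]
  set G : α → ℝ := fun a => Real.log (∫ b, Real.exp (g (a, b)) ∂(η a)) with hG
  have hGm : Measurable G :=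
    (StronglyMeasurable.integral_kernel_prod_right'
      (f := fun x => Real.exp (g x)) hg.exp.stronglyMeasurable).measurable.log
  have hGb : ∀ a, |G a| ≤ M := fun a => abs_log_integral_exp_le (hga a) fun b => hM _
  have hGi := integrable_of_abs_le (μ := μ) hGm hGb
  have hJ : Integrable (fun a => ∫ b, g (a, b) ∂(κ a)) μ :=
    integrable_of_abs_le (M := M) (StronglyMeasurable.integral_kernel_prod_right'
      hg.stronglyMeasurable).measurable fun a => by
        simpa using norm_integral_le_of_norm_le_const (μ := κ a) (f := fun b => g (a, b))
          (Eventually.of_forall fun b => hM (a, b))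
  have h1 : ∫ a, ∫ b, g (a, b) ∂(κ a) ∂μ ≤ ∫ a, (d a + G a) ∂μ :=
    integral_mono hJ (hd.add hGi) fun a =>
      hκ a _ (hga a) ⟨M, fun b => hM _⟩
  have h2 := h G hGm ⟨M, hGb⟩
  have h3 : ∀ a, Real.exp (G a) = ∫ b, Real.exp (g (a, b)) ∂(η a) := fun a =>
    Real.exp_log (integral_exp_pos (integrable_exp_of_abs_le (hga a) fun b => hM _))
  simp only [h3] at h2
  rw [integral_add hd hGi] at h1
  linarith

/-- The test functions are the multiples `l` of the indicator of `A`. Letting `l` be large excludes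
`ν.real A = 0`; then `l = -log ν(A)` turns the log-partition term into log 2. -/
theorem EntropyBound.tail {μ ν : Measure α} [IsProbabilityMeasure μ] [IsProbabilityMeasure ν]
    {k : ℝ} (h : EntropyBound μ ν k) {A : Set α} (hA : MeasurableSet A) (hμ : 0 < μ.real A) :
    0 < ν.real A ∧ -Real.log (ν.real A) * μ.real A ≤ k + Real.log 2 := by
  have key : ∀ l : ℝ, l * μ.real A ≤ k + Real.log (1 + Real.exp l * ν.real A) := by
    intro l
    have hm : Measurable (A.indicator fun _ => l) := measurable_const.indicator hA
    have hb : ∀ x, |A.indicator (fun _ => l) x| ≤ |l| := fun x => by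
      by_cases hx : x ∈ A <;> simp [hx]
    have h1 := h _ hm ⟨_, hb⟩
    have h2 : ∫ x, Real.exp (A.indicator (fun _ => l) x) ∂ν ≤ 1 + Real.exp l * ν.real A := by
      have h3 := integral_mono (μ := ν) (integrable_exp_of_abs_le hm hb)
        ((integrable_const (1 : ℝ)).add ((integrable_const (Real.exp l)).indicator hA))
        fun x => by
          by_cases hx : x ∈ A <;> simp [hx]
      have h4 : ∫ x, ((fun _ : α => (1 : ℝ)) + A.indicator (fun _ => Real.exp l)) x ∂ν
          = 1 + Real.exp l * ν.real A := by
        rw [integral_add' (integrable_const (1 : ℝ))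
          ((integrable_const (Real.exp l)).indicator hA), integral_indicator_const _ hA]
        simp [mul_comm]
      linarith
    have h5 := Real.log_le_log (integral_exp_pos (integrable_exp_of_abs_le (μ := ν) hm hb)) h2
    rw [integral_indicator_const _ hA, smul_eq_mul, mul_comm] at h1
    linarith
  have hν : 0 < ν.real A := by
    refine measureReal_nonneg.lt_of_ne' fun h0 => ?_
    have := key ((k + 1) / μ.real A)
    rw [h0, div_mul_cancel₀ _ hμ.ne'] at this
    simp at this
    linarith
  refine ⟨hν, ?_⟩
  have := key (-Real.log (ν.real A))
  rw [Real.exp_neg, Real.exp_log hν, inv_mul_cancel₀ hν.ne'] at this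
  norm_num at this ⊢
  exact this

end Entropy

/-! ### Entropy of Gaussian rewards, rounds and histories -/

theorem entropyBound_gaussianReal (m m' : ℝ) {v : ℝ≥0} (hv : v ≠ 0) :
    EntropyBound (gaussianReal m v) (gaussianReal m' v) ((m - m') ^ 2 / (2 * v)) := by
  rintro g hg ⟨M, hM⟩
  have hv' : (v : ℝ) ≠ 0 := by exact_mod_cast hv
  -- The log-likelihood ratio of the second Gaussian to the first; Jensen's inequality is applied to
  -- `g + L`.
  set L : ℝ → ℝ := fun x => (m' - m) / v * x + (m ^ 2 - m' ^ 2) / (2 * v) with hL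
  have hpdf : ∀ x, gaussianPDFReal m v x * Real.exp (L x) = gaussianPDFReal m' v x := by
    intro x
    rw [gaussianPDFReal, gaussianPDFReal, mul_assoc, ← Real.exp_add]
    congr 2
    simp only [hL]
    field_simp
    ring
  have hid : Integrable (fun x : ℝ => x) (gaussianReal m v) :=
    (memLp_id_gaussianReal 1).integrable le_rfl
  have hLi : Integrable L (gaussianReal m v) := (hid.const_mul _).add (integrable_const _)
  have hLint : ∫ x, L x ∂(gaussianReal m v) = -((m - m') ^ 2 / (2 * v)) := by
    simp only [hL]
    rw [integral_add (hid.const_mul _) (integrable_const _), integral_const_mul,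
      integral_id_gaussianReal]
    simp
    field_simp
    ring
  have hgi : Integrable g (gaussianReal m v) := integrable_of_abs_le hg hM
  have hei : Integrable (fun x => Real.exp (g x + L x)) (gaussianReal m v) := by
    have := integrable_exp_of_abs_le (μ := gaussianReal m' v) hg hM
    rw [gaussianReal_of_var_ne_zero _ hv, integrable_withDensity_iff_integrable_smul'
      (measurable_gaussianPDF _ _) (ae_of_all _ fun _ => gaussianPDF_lt_top)] at this ⊢
    refine this.congr (Eventually.of_forall fun x => ?_)
    simp only [toReal_gaussianPDF, smul_eq_mul]
    rw [← hpdf, Real.exp_add (g x), mul_assoc, mul_comm (Real.exp (L x))]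
  have h1 := integral_le_log_integral_exp (hgi.add hLi) hei
  have h2 : ∫ x, Real.exp ((g + L) x) ∂(gaussianReal m v)
      = ∫ x, Real.exp (g x) ∂(gaussianReal m' v) := by
    rw [integral_gaussianReal_eq_integral_smul hv, integral_gaussianReal_eq_integral_smul hv]
    congr 1
    ext x
    rw [← hpdf, Pi.add_apply, Real.exp_add]
    simp only [smul_eq_mul]
    ring
  rw [h2, integral_add' hgi hLi, hLint] at h1
  linarith

/-- The relative entropy of the reward of arm `a` under `θ` with respect to that under `θ'`. -/
noncomputable def armEntropy {K : ℕ} (σ : ℝ≥0) (θ θ' : Fin K → ℝ) (a : Fin K) : ℝ :=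
  (θ a - θ' a) ^ 2 / (2 * (σ : ℝ) ^ 2)

/-- The draw of the arm has the same law under both mean vectors and costs nothing; only the reward
contributes. -/
theorem entropyBound_roundKernel {K : ℕ} {σ : ℝ≥0} (hσ : 0 < σ) (p : Policy K) (θ θ' : Fin K → ℝ)
    (t : ℕ) (h : History K t) :
    EntropyBound (roundKernel σ p θ t h) (roundKernel σ p θ' t h)
      (∫ a, armEntropy σ θ θ' a ∂(p.select t h)) := by
  unfold roundKernel
  rw [Kernel.compProd_apply_eq_compProd_sectR, Kernel.compProd_apply_eq_compProd_sectR,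
    ← zero_add (∫ a, armEntropy σ θ θ' a ∂(p.select t h))]
  refine (entropyBound_refl _).compProd Integrable.of_finite fun a => ?_
  have := entropyBound_gaussianReal (θ a) (θ' a) (pow_ne_zero 2 hσ.ne')
  simpa [armEntropy, rewardKernel, Kernel.ofFunOfCountable] using this

theorem map_fst_roundKernel {K : ℕ} (σ : ℝ≥0) (p : Policy K) (θ : Fin K → ℝ) (t : ℕ)
    (h : History K t) : (roundKernel σ p θ t h).map Prod.fst = p.select t h := by
  unfold roundKernel
  rw [Kernel.compProd_apply_eq_compProd_sectR]
  exact Measure.fst_compProd _ _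

theorem pulls_snoc {K t : ℕ} (h : History K t) (z : Fin K × ℝ) (a : Fin K) :
    (pulls (Fin.snoc (α := fun _ => Fin K × ℝ) h z : History K (t + 1)) a : ℝ)
      = pulls h a + if z.1 = a then 1 else 0 := by
  simp only [pulls, Finset.card_filter, Fin.sum_univ_castSucc, Fin.snoc_castSucc, Fin.snoc_last]
  push_cast
  rfl

theorem measurable_pulls {K t : ℕ} (a : Fin K) :
    Measurable fun h : History K t => (pulls h a : ℝ) := by
  simp only [pulls, Finset.card_filter, Nat.cast_sum]
  refine Finset.measurable_sum _ fun s _ => ?_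
  push_cast
  exact Measurable.ite (measurableSet_eq_fun (measurable_fst.comp (measurable_pi_apply s))
    measurable_const) measurable_const measurable_const

theorem pulls_le {K t : ℕ} (h : History K t) (a : Fin K) : pulls h a ≤ t := by
  simpa [pulls] using Finset.card_filter_le (Finset.univ : Finset (Fin t)) fun s => (h s).1 = a

theorem integrable_pulls {K t : ℕ} (μ : Measure (History K t)) [IsFiniteMeasure μ] (a : Fin K) :
    Integrable (fun h => (pulls h a : ℝ)) μ :=
  integrable_of_abs_le (M := t) (measurable_pulls a) fun h => by
    rw [Nat.abs_cast]
    exact_mod_cast pulls_le h a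

theorem entropyBound_historyLaw {K : ℕ} {σ : ℝ≥0} (hσ : 0 < σ) (p : Policy K)
    (θ θ' : Fin K → ℝ) (t : ℕ) :
    EntropyBound (historyLaw σ p θ t) (historyLaw σ p θ' t)
      (∫ h, ∑ a, (pulls h a : ℝ) * armEntropy σ θ θ' a ∂(historyLaw σ p θ t)) := by
  induction t with
  | zero =>
    have : ∀ h : History K 0, ∑ a, (pulls h a : ℝ) * armEntropy σ θ θ' a = 0 := by
      intro h; simp [pulls]
    simp only [this, integral_zero]
    exact entropyBound_refl _
  | succ t ih =>
    have hcm : ∀ s, Measurable fun h : History K s =>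
        ∑ a, (pulls h a : ℝ) * armEntropy σ θ θ' a := fun s =>
      Finset.measurable_sum _ fun a _ => (measurable_pulls a).mul_const _
    have hci : ∀ s (μ : Measure (History K s)) [IsFiniteMeasure μ], Integrable (fun h =>
        ∑ a, (pulls h a : ℝ) * armEntropy σ θ θ' a) μ := fun s μ _ =>
      integrable_finsetSum _ fun a _ => (integrable_pulls μ a).mul_const _
    have hdm : Measurable fun h : History K t => ∫ a, armEntropy σ θ θ' a ∂(p.select t h) :=
      (StronglyMeasurable.integral_kernel (κ := p.select t)
        (measurable_of_countable (armEntropy σ θ θ')).stronglyMeasurable).measurable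
    have hdi : Integrable (fun h => ∫ a, armEntropy σ θ θ' a ∂(p.select t h))
        (historyLaw σ p θ t) := by
      refine integrable_of_abs_le (M := ∑ a, |armEntropy σ θ θ' a|) hdm fun h => ?_
      have := norm_integral_le_of_norm_le_const (μ := p.select t h)
        (f := armEntropy σ θ θ') (C := ∑ a, |armEntropy σ θ θ' a|)
        (Eventually.of_forall fun a => Finset.single_le_sum
          (f := fun a => |armEntropy σ θ θ' a|) (fun _ _ => abs_nonneg _) (Finset.mem_univ a))
      simpa using this
    have hstep := (ih.compProd hdi (entropyBound_roundKernel hσ p θ θ' t)).map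
      (measurable_snoc (K := K) (t := t))
    -- The cost of the new round is that of the arm drawn in it, which is what the increment of the
    -- pull counts records.
    have hk : ∫ h, ∑ a, (pulls h a : ℝ) * armEntropy σ θ θ' a ∂(historyLaw σ p θ (t + 1))
        = ∫ h, ∑ a, (pulls h a : ℝ) * armEntropy σ θ θ' a ∂(historyLaw σ p θ t)
          + ∫ h, ∫ a, armEntropy σ θ θ' a ∂(p.select t h) ∂(historyLaw σ p θ t) := by
      have hi := hci (t + 1) (historyLaw σ p θ (t + 1))
      simp only [historyLaw] at hi ⊢
      rw [integrable_map_measure (hcm _).aestronglyMeasurable measurable_snoc.aemeasurable] at hi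
      rw [integral_map measurable_snoc.aemeasurable (hcm _).aestronglyMeasurable,
        Measure.integral_compProd (by exact hi), ← integral_add (hci t _) hdi]
      congr 1
      ext h
      simp only [pulls_snoc, add_mul, Finset.sum_add_distrib, ite_mul, one_mul, zero_mul,
        Finset.sum_ite_eq, Finset.mem_univ, if_true]
      have hr : Integrable (fun z => armEntropy σ θ θ' z.1) (roundKernel σ p θ t h) := by
        have : Integrable (armEntropy σ θ θ') ((roundKernel σ p θ t h).map Prod.fst) := by
          rw [map_fst_roundKernel]; exact Integrable.of_finite
        exact this.comp_measurable measurable_fst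
      rw [integral_add (integrable_const _) hr, ← map_fst_roundKernel σ p θ t h,
        integral_map measurable_fst.aemeasurable
          (measurable_of_countable _).aestronglyMeasurable]
      simp
    rw [hk]
    exact hstep

/-! ### Regret with two arms and the change of measure -/

theorem gap_of_isMax {K : ℕ} {θ : Fin K → ℝ} {b : Fin K} (hb : ∀ a, θ a ≤ θ b) (a : Fin K) :
    gap θ a = θ b - θ a := by
  have : Nonempty (Fin K) := ⟨b⟩
  rw [gap, le_antisymm (ciSup_le hb) (le_ciSup (Set.finite_range θ).bddAbove b)]

theorem pseudoRegret_of_lt {θ : Fin 2 → ℝ} (h01 : θ 0 < θ 1) {t : ℕ} (h : History 2 t) :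
    pseudoRegret θ h = pulls h 0 * (θ 1 - θ 0) := by
  have hb : ∀ a, θ a ≤ θ 1 := by
    intro a; fin_cases a
    exacts [h01.le, le_rfl]
  simp [pseudoRegret, gap_of_isMax hb]

theorem pseudoRegret_of_gt {θ : Fin 2 → ℝ} (h10 : θ 1 < θ 0) {t : ℕ} (h : History 2 t) :
    pseudoRegret θ h = pulls h 1 * (θ 0 - θ 1) := by
  have hb : ∀ a, θ a ≤ θ 0 := by
    intro a; fin_cases a
    exacts [le_rfl, h10.le]
  simp [pseudoRegret, gap_of_isMax hb]

theorem expectedRegret_nonneg {K : ℕ} (σ : ℝ≥0) (π : FixedTimePolicy K) (θ : Fin K → ℝ) (T : ℕ) :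
    0 ≤ expectedRegret σ π θ T :=
  integral_nonneg fun h => pseudoRegret_nonneg θ h

theorem regretTail_antitone {K : ℕ} (σ : ℝ≥0) (π : FixedTimePolicy K) (θ : Fin K → ℝ) (T : ℕ) :
    Antitone (regretTail σ π θ T) := fun _ _ hxy =>
  measureReal_mono fun _ hz => lt_of_le_of_lt hxy hz

theorem regretTail_le_div {K : ℕ} (σ : ℝ≥0) (π : FixedTimePolicy K) {θ : Fin K → ℝ}
    (hθ : θ ∈ means K) (T : ℕ) {y : ℝ} (hy : 0 < y) :
    regretTail σ π θ T y ≤ expectedRegret σ π θ T / y := by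
  rw [le_div_iff₀ hy, mul_comm]
  refine le_trans ?_ (mul_meas_ge_le_integral_of_nonneg
    (Eventually.of_forall fun h => pseudoRegret_nonneg θ h)
    (integrable_pseudoRegret σ (π T) hθ T) y)
  exact mul_le_mul_of_nonneg_left
    (measureReal_mono fun h hh => le_of_lt (show y < pseudoRegret θ h from hh)) hy.le

/-- If the expected regret under `θ'` is small, the regret under `θ` has a heavy tail. -/
theorem regretTail_lower_bound {σ : ℝ≥0} (hσ : 0 < σ) (π : FixedTimePolicy 2) {θ θ' : Fin 2 → ℝ}
    (hθ' : θ' ∈ means 2) (h01 : θ 0 < θ 1) (h0 : θ 0 = θ' 0) (h10 : θ' 1 < θ' 0) (T : ℕ)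
    {y : ℝ} (hy : 0 < T - y / (θ 1 - θ 0))
    (hR : 2 * expectedRegret σ π θ' T ≤ (θ' 0 - θ' 1) * (T - y / (θ 1 - θ 0))) :
    0 < regretTail σ π θ T y ∧
      -Real.log (regretTail σ π θ T y) ≤
        2 * ((θ 1 - θ' 1) ^ 2 / (2 * (σ : ℝ) ^ 2) / (θ' 0 - θ' 1) * expectedRegret σ π θ' T
          + Real.log 2) := by
  set Δ := θ 1 - θ 0
  set Δ' := θ' 0 - θ' 1 with hΔ'
  have hΔ : 0 < Δ := sub_pos.2 h01
  have hΔ'0 : 0 < Δ' := sub_pos.2 h10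
  set s := (T : ℝ) - y / Δ with hs
  set μ := historyLaw σ (π T) θ' T with hμ
  set A : Set (History 2 T) := {h | y < pseudoRegret θ h} with hA
  have hAm : MeasurableSet A := measurableSet_lt measurable_const (measurable_pseudoRegret θ)
  -- Off `A`, arm 0 is pulled at most `y / Δ` times, so arm 1 at least `s` times.
  have hB : Aᶜ ⊆ {h | Δ' * s ≤ pseudoRegret θ' h} := by
    intro h hh
    have h1 : pseudoRegret θ h ≤ y := not_lt.1 hh
    have h2 : (pulls h 0 : ℝ) + pulls h 1 = T := by
      have := sum_pulls h
      rw [Fin.sum_univ_two] at this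
      exact_mod_cast this
    rw [pseudoRegret_of_lt h01, ← le_div_iff₀ hΔ] at h1
    change Δ' * s ≤ pseudoRegret θ' h
    rw [pseudoRegret_of_gt h10, mul_comm]
    exact mul_le_mul_of_nonneg_right (by linarith) hΔ'0.le
  have hhalf : 1 / 2 ≤ μ.real A := by
    have h1 := mul_meas_ge_le_integral_of_nonneg (μ := μ)
      (Eventually.of_forall fun h => pseudoRegret_nonneg θ' h)
      (integrable_pseudoRegret σ (π T) hθ' T) (Δ' * s)
    have h2 : (Δ' * s) * μ.real Aᶜ ≤ expectedRegret σ π θ' T :=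
      (mul_le_mul_of_nonneg_left (measureReal_mono hB) (mul_pos hΔ'0 hy).le).trans h1
    have h3 : μ.real Aᶜ ≤ 1 / 2 := by
      have hp := mul_pos hΔ'0 hy
      by_contra! hc
      nlinarith
    rw [probReal_compl_eq_one_sub hAm] at h3
    linarith
  obtain ⟨hpos, hle⟩ := (entropyBound_historyLaw hσ (π T) θ' θ T).tail hAm (by linarith)
  refine ⟨hpos, ?_⟩
  -- Arm 0 contributes no entropy, and the pulls of arm 1 are the regret under `θ'` divided by `Δ'`.
  have hk : ∫ h, ∑ a, (pulls h a : ℝ) * armEntropy σ θ' θ a ∂μ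
      = (θ 1 - θ' 1) ^ 2 / (2 * (σ : ℝ) ^ 2) / Δ' * expectedRegret σ π θ' T := by
    rw [expectedRegret, ← integral_const_mul]
    congr 1
    ext h
    rw [pseudoRegret_of_gt h10, Fin.sum_univ_two]
    simp only [armEntropy, h0, sub_self]
    rw [← hΔ']
    field_simp
    ring
  rw [hk] at hle
  have hlog : 0 ≤ -Real.log ((historyLaw σ (π T) θ T).real A) :=
    neg_nonneg.2 (Real.log_nonpos measureReal_nonneg measureReal_le_one)
  change -Real.log ((historyLaw σ (π T) θ T).real A) ≤ _
  nlinarith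

/-! ### Absorbing log 2, and consequences of the limsup hypotheses -/

theorem neg_log_le_of_le_sixteenth {q E : ℝ} (hq : 0 < q) (hq' : q ≤ 1 / 16)
    (h : -Real.log q ≤ 2 * (E + Real.log 2)) : Real.log 2 ≤ E ∧ -Real.log q ≤ 4 * E := by
  have h1 := Real.log_le_log hq hq'
  have h2 : Real.log (1 / 16) = -(4 * Real.log 2) := by
    rw [one_div, Real.log_inv, show (16 : ℝ) = 2 ^ 4 by norm_num, Real.log_pow]
    norm_num
  constructor <;> linarith

theorem eventually_lt_of_limsup_coe_lt {u : ℕ → ℝ} {r : ℝ}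
    (h : limsup (fun T => (u T : EReal)) atTop < (r : EReal)) : ∀ᶠ T in atTop, u T < r :=
  (eventually_lt_of_limsup_lt h).mono fun _ hT => EReal.coe_lt_coe_iff.1 hT

theorem eventually_lt_of_limsup_coe_eq_zero {u : ℕ → ℝ}
    (h : limsup (fun T => (u T : EReal)) atTop = 0) {ε : ℝ} (hε : 0 < ε) :
    ∀ᶠ T in atTop, u T < ε :=
  eventually_lt_of_limsup_coe_lt (by rw [h]; exact_mod_cast hε)

theorem exists_eventually_lt {u : ℕ → ℝ} {b a : ℝ} (hab : a < b)
    (h : limsup (fun T => (u T : EReal)) atTop < (b : EReal)) :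
    ∃ r, a < r ∧ r < b ∧ ∀ᶠ T in atTop, u T < r := by
  obtain ⟨r, hr, hrb⟩ := EReal.lt_iff_exists_real_btwn.1 (max_lt h (EReal.coe_lt_coe_iff.2 hab))
  exact ⟨r, EReal.coe_lt_coe_iff.1 ((le_max_right _ _).trans_lt hr), EReal.coe_lt_coe_iff.1 hrb,
    eventually_lt_of_limsup_coe_lt ((le_max_left _ _).trans_lt hr)⟩

/-! ### Bounds at a fixed horizon -/

theorem expectedRegret_le_worstRegret {K : ℕ} (σ : ℝ≥0) (π : FixedTimePolicy K) (T : ℕ)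
    {θ : Fin K → ℝ} (hθ : θ ∈ means K) : expectedRegret σ π θ T ≤ worstRegret σ π T :=
  le_ciSup (bddAbove_expectedRegret σ π T) ⟨θ, hθ⟩

theorem regretTail_le_worstTail {K : ℕ} (σ : ℝ≥0) (π : FixedTimePolicy K) (T : ℕ) (x : ℝ)
    {θ : Fin K → ℝ} (hθ : θ ∈ means K) : regretTail σ π θ T x ≤ worstTail σ π T x :=
  le_ciSup (bddAbove_regretTail σ π T x) ⟨θ, hθ⟩

theorem worstTail_le_div {K : ℕ} (σ : ℝ≥0) (π : FixedTimePolicy K) (T : ℕ) {y : ℝ} (hy : 0 < y) :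
    worstTail σ π T y ≤ worstRegret σ π T / y := by
  have : Nonempty (means K) := ⟨⟨0, fun _ => ⟨le_rfl, zero_le_one⟩⟩⟩
  exact ciSup_le fun θ => (regretTail_le_div σ π θ.2 T hy).trans
    (div_le_div_of_nonneg_right (expectedRegret_le_worstRegret σ π T θ.2) hy.le)

theorem worstTail_bounds {σ : ℝ≥0} (hσ : 0 < σ) (π : FixedTimePolicy 2) {T : ℕ} (hT : 0 < T)
    {x r : ℝ} (hx : 0 < x) (hr : 1 / 4 < r) (hr2 : r < 1 / 2) (hxr : x / T < r)
    (hW : worstRegret σ π T / x < min (1 / 16) ((1 / (2 * r) - 1) / 2)) :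
    0 < worstRegret σ π T ∧ 0 < worstTail σ π T x ∧
      -Real.log (worstTail σ π T x) ≤ 16 / (σ : ℝ) ^ 2 * (x * worstRegret σ π T / T) := by
  have hT' : (0 : ℝ) < T := by exact_mod_cast hT
  have hr0 : 0 < r := by linarith
  have hσ' : (0 : ℝ) < σ := hσ
  set W := worstRegret σ π T with hWdef
  -- The gap `D = c * (x / T)` must exceed `x / T`, so that always pulling the bad arm costs more
  -- than `x`, and be at most 1/2, so that the means stay in [0, 1]. As 1/4 < `r` < 1/2, this `c`
  -- does both and is at most 2.
  set c := 1 / (2 * r) with hc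
  have hcr : c * r = 1 / 2 := by rw [hc]; field_simp
  have hc1 : 1 < c := by
    by_contra! h
    nlinarith
  have hc2 : c ≤ 2 := by
    by_contra! h
    nlinarith
  set D := c * (x / T) with hD
  have hxT : 0 < x / T := div_pos hx hT'
  have hD0 : 0 < D := mul_pos (by linarith) hxT
  have hD2 : D ≤ 1 / 2 := by
    rw [← hcr]
    exact mul_le_mul_of_nonneg_left hxr.le (by linarith)
  have hθ : (![1 / 2, 1 / 2 + D] : Fin 2 → ℝ) ∈ means 2 := by
    intro a
    fin_cases a <;> constructor <;> simp <;> linarith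
  have hθ' : (![1 / 2, 1 / 2 - D] : Fin 2 → ℝ) ∈ means 2 := by
    intro a
    fin_cases a <;> constructor <;> simp <;> linarith
  have hs : (T : ℝ) - x / D = T * (1 - 1 / c) := by
    rw [hD]; field_simp
  have hc0 : 0 < 1 - 1 / c := by
    rw [sub_pos, div_lt_one (by linarith)]; exact hc1
  have hWx : 2 * W ≤ D * (T * (1 - 1 / c)) := by
    have h1 : W / x < (c - 1) / 2 := hW.trans_le (min_le_right _ _)
    rw [div_lt_iff₀ hx] at h1
    have h2 : D * (T * (1 - 1 / c)) = (c - 1) * x := by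
      rw [hD]; field_simp
    rw [h2]; linarith
  have hRW := expectedRegret_le_worstRegret σ π T hθ'
  obtain ⟨hq, hlog⟩ := regretTail_lower_bound hσ π (θ := ![1 / 2, 1 / 2 + D])
    (θ' := ![1 / 2, 1 / 2 - D]) hθ' (by simpa using hD0) (by simp) (by simpa using hD0) T (y := x)
    (by simpa [hs] using mul_pos hT' hc0)
    (by
      simp only [Matrix.cons_val_zero, Matrix.cons_val_one, add_sub_cancel_left, sub_sub_cancel]
      rw [hs]
      linarith)
  simp only [Matrix.cons_val_zero, Matrix.cons_val_one, sub_sub_cancel] at hlog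
  have hqW := regretTail_le_worstTail σ π T x hθ
  have hQ : 0 < worstTail σ π T x := hq.trans_le hqW
  have hQ' : worstTail σ π T x ≤ W / x := worstTail_le_div σ π T hx
  have hW0 : 0 < W := by
    have := hQ.trans_le hQ'
    by_contra! h
    exact absurd (div_nonpos_of_nonpos_of_nonneg h hx.le) (not_le.2 this)
  refine ⟨hW0, hQ, ?_⟩
  set κ := (1 / 2 + D - (1 / 2 - D)) ^ 2 / (2 * (σ : ℝ) ^ 2) / D with hκ
  have hκ' : κ = 2 / (σ : ℝ) ^ 2 * D := by
    rw [hκ]; field_simp; ring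
  have hκ0 : 0 ≤ κ := by rw [hκ']; positivity
  have h1 : -Real.log (worstTail σ π T x) ≤ 2 * (κ * W + Real.log 2) := by
    have h2 := Real.log_le_log hq hqW
    have h3 := mul_le_mul_of_nonneg_left hRW hκ0
    linarith
  refine (neg_log_le_of_le_sixteenth hQ (hQ'.trans (hW.le.trans (min_le_left _ _))) h1).2.trans ?_
  calc 4 * (κ * W) = 8 * c / (σ : ℝ) ^ 2 * (x * W / T) := by rw [hκ', hD]; ring
    _ ≤ 16 / (σ : ℝ) ^ 2 * (x * W / T) := by gcongr; linarith

theorem regretTail_bounds {σ : ℝ≥0} (hσ : 0 < σ) (π : FixedTimePolicy 2) {θ θ' : Fin 2 → ℝ}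
    (hθ : θ ∈ means 2) (hθ' : θ' ∈ means 2) (h01 : θ 0 < θ 1) (h0 : θ 0 = θ' 0)
    (h10 : θ' 1 < θ' 0) {T : ℕ} (hT : 0 < T) {x r : ℝ} (hr : 0 < r) (hr2 : r < θ 1 - θ 0)
    (hxr : x / T < r) (hR : expectedRegret σ π θ T / T < r / 16)
    (hR' : expectedRegret σ π θ' T / T < (θ' 0 - θ' 1) * (1 - r / (θ 1 - θ 0)) / 2) :
    0 < expectedRegret σ π θ' T ∧ 0 < regretTail σ π θ T x ∧
      -Real.log (regretTail σ π θ T x) ≤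
        4 * ((θ 1 - θ' 1) ^ 2 / (2 * (σ : ℝ) ^ 2) / (θ' 0 - θ' 1)) *
          expectedRegret σ π θ' T := by
  have hT' : (0 : ℝ) < T := by exact_mod_cast hT
  have hΔ : 0 < θ 1 - θ 0 := sub_pos.2 h01
  have hs : (T : ℝ) - r * T / (θ 1 - θ 0) = T * (1 - r / (θ 1 - θ 0)) := by ring
  have hs0 : 0 < 1 - r / (θ 1 - θ 0) := by
    rw [sub_pos, div_lt_one hΔ]; exact hr2
  rw [div_lt_iff₀ hT'] at hxr hR hR'
  -- The level `r * T` replaces `x`, which may be small or negative: Markov's inequality then gives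
  -- 1/16, and monotonicity of the tail returns to `x`.
  obtain ⟨hq, hlog⟩ := regretTail_lower_bound hσ π hθ' h01 h0 h10 T (y := r * T)
    (by rw [hs]; exact mul_pos hT' hs0) (by rw [hs]; linarith)
  have hq16 : regretTail σ π θ T (r * T) ≤ 1 / 16 := by
    refine (regretTail_le_div σ π hθ T (mul_pos hr hT')).trans ?_
    rw [div_le_iff₀ (mul_pos hr hT')]
    linarith
  obtain ⟨hE, hlog'⟩ := neg_log_le_of_le_sixteenth hq hq16 hlog
  have hmono := regretTail_antitone σ π θ T hxr.le
  refine ⟨?_, hq.trans_le hmono, ?_⟩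
  · refine (expectedRegret_nonneg σ π θ' T).lt_of_ne fun h => ?_
    rw [← h, mul_zero] at hE
    exact absurd hE (not_le.2 (Real.log_pos one_lt_two))
  · have := Real.log_le_log hq hmono
    linarith

end Bandit

/-! ### Passage to the limit inferior -/

theorem mainTheorem1 (σ : ℝ≥0) (hσ : 0 < σ) :
    -- Worst case: the constant depends only on `σ`.
    (∃ C : ℝ, 0 < C ∧ ∀ (π : Bandit.FixedTimePolicy 2) (x : ℕ → ℝ),
      limsup (fun T : ℕ => ((Bandit.worstRegret σ π T / T : ℝ) : EReal)) atTop = 0 →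
      (∀ᶠ T : ℕ in atTop, 0 < x T) →
      limsup (fun T : ℕ => ((x T / T : ℝ) : EReal)) atTop < ((1 / 2 : ℝ) : EReal) →
      limsup (fun T : ℕ => ((Bandit.worstRegret σ π T / x T : ℝ) : EReal)) atTop = 0 →
      (∀ᶠ T : ℕ in atTop, 0 < Bandit.worstRegret σ π T) ∧
      (∀ᶠ T : ℕ in atTop, 0 < Bandit.worstTail σ π T (x T)) ∧
      ((-C : ℝ) : EReal) ≤ liminf (fun T : ℕ =>
        ((Real.log (Bandit.worstTail σ π T (x T)) * T / (x T * Bandit.worstRegret σ π T) *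
          min 1 (Real.sqrt (x T * Bandit.worstRegret σ π T / (T * Real.log T))) : ℝ) : EReal))
        atTop) ∧
    -- Instance-dependent: the constant depends only on `σ` and the two instances.
    (∀ θ ∈ Bandit.means 2, ∀ θ' ∈ Bandit.means 2,
      θ 0 < θ 1 → θ 0 = θ' 0 → θ' 1 < θ' 0 →
      ∃ C : ℝ, 0 < C ∧ ∀ (π : Bandit.FixedTimePolicy 2) (x : ℕ → ℝ),
        (∀ ϑ ∈ Bandit.means 2,
          limsup (fun T : ℕ => ((Bandit.expectedRegret σ π ϑ T / T : ℝ) : EReal)) atTop = 0) →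
        limsup (fun T : ℕ => ((x T / T : ℝ) : EReal)) atTop < ((θ 1 - θ 0 : ℝ) : EReal) →
        (∀ᶠ T : ℕ in atTop, 0 < Bandit.expectedRegret σ π θ' T) ∧
        (∀ᶠ T : ℕ in atTop, 0 < Bandit.regretTail σ π θ T (x T)) ∧
        ((-C : ℝ) : EReal) ≤ liminf (fun T : ℕ =>
          ((Real.log (Bandit.regretTail σ π θ T (x T)) / Bandit.expectedRegret σ π θ' T : ℝ) :
            EReal)) atTop) := by
  refine ⟨⟨16 / (σ : ℝ) ^ 2, by have : (0 : ℝ) < σ := hσ; positivity, ?_⟩, ?_⟩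
  · intro π x _ hx hxT hWx
    -- Keeping `r` above 1/4 makes the final constant independent of `π` and `x`.
    obtain ⟨r, hr, hr2, hxr⟩ := Bandit.exists_eventually_lt (a := 1 / 4) (by norm_num) hxT
    have hε : 0 < min (1 / 16) ((1 / (2 * r) - 1) / 2) := by
      refine lt_min (by norm_num) (half_pos (sub_pos.2 ?_))
      rw [lt_div_iff₀ (by linarith)]
      linarith
    have hall : ∀ᶠ T : ℕ in atTop, (0 < T ∧ 0 < x T) ∧
        0 < Bandit.worstRegret σ π T ∧ 0 < Bandit.worstTail σ π T (x T) ∧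
        -Real.log (Bandit.worstTail σ π T (x T)) ≤
          16 / (σ : ℝ) ^ 2 * (x T * Bandit.worstRegret σ π T / T) := by
      filter_upwards [hx, hxr, Bandit.eventually_lt_of_limsup_coe_eq_zero hWx hε,
        eventually_gt_atTop 0] with T h1 h2 h3 h4
      exact ⟨⟨h4, h1⟩, Bandit.worstTail_bounds hσ π h4 h1 hr hr2 h2 h3⟩
    refine ⟨hall.mono fun T h => h.2.1, hall.mono fun T h => h.2.2.1, ?_⟩
    refine le_liminf_of_le (by isBoundedDefault) (hall.mono ?_)
    rintro T ⟨⟨hT, hxpos⟩, hW, hQ, hlog⟩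
    have hT' : (0 : ℝ) < T := by exact_mod_cast hT
    rw [EReal.coe_le_coe_iff]
    set L := Real.log (Bandit.worstTail σ π T (x T))
    set W := Bandit.worstRegret σ π T
    set m := min 1 (Real.sqrt (x T * W / (T * Real.log T)))
    have hm0 : 0 ≤ m := le_min zero_le_one (Real.sqrt_nonneg _)
    have hm1 : m ≤ 1 := min_le_left _ _
    have hC : 0 ≤ 16 / (σ : ℝ) ^ 2 := by positivity
    have hxW : 0 < x T * W := mul_pos hxpos hW
    have h1 : -(16 / (σ : ℝ) ^ 2) ≤ L * T / (x T * W) := by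
      rw [le_div_iff₀ hxW]
      have h2 := mul_le_mul_of_nonneg_right hlog hT'.le
      rw [mul_assoc, div_mul_cancel₀ _ hT'.ne'] at h2
      linarith
    -- The bound already holds without the factor `m`; since 0 ≤ `m` ≤ 1, multiplying by it
    -- preserves the lower bound.
    nlinarith [mul_le_mul_of_nonneg_right h1 hm0]
  · intro θ hθ θ' hθ' h01 h0 h10
    have hσ' : (0 : ℝ) < σ := hσ
    have hC : 0 < 4 * ((θ 1 - θ' 1) ^ 2 / (2 * (σ : ℝ) ^ 2) / (θ' 0 - θ' 1)) := by
      have h1 : 0 < θ' 0 - θ' 1 := sub_pos.2 h10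
      have h2 : 0 < θ 1 - θ' 1 := by linarith
      positivity
    refine ⟨_, hC, ?_⟩
    intro π x hR hxT
    have hΔ : 0 < θ 1 - θ 0 := sub_pos.2 h01
    obtain ⟨r, hr, hr2, hxr⟩ := Bandit.exists_eventually_lt hΔ hxT
    have hε : 0 < (θ' 0 - θ' 1) * (1 - r / (θ 1 - θ 0)) / 2 := by
      refine half_pos (mul_pos (sub_pos.2 h10) (sub_pos.2 ?_))
      rw [div_lt_one hΔ]
      exact hr2
    have hall : ∀ᶠ T : ℕ in atTop,
        0 < Bandit.expectedRegret σ π θ' T ∧ 0 < Bandit.regretTail σ π θ T (x T) ∧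
        -Real.log (Bandit.regretTail σ π θ T (x T)) ≤
          4 * ((θ 1 - θ' 1) ^ 2 / (2 * (σ : ℝ) ^ 2) / (θ' 0 - θ' 1)) *
            Bandit.expectedRegret σ π θ' T := by
      filter_upwards [hxr, eventually_gt_atTop 0,
        Bandit.eventually_lt_of_limsup_coe_eq_zero (hR θ hθ) (by positivity : 0 < r / 16),
        Bandit.eventually_lt_of_limsup_coe_eq_zero (hR θ' hθ') hε] with T h1 h2 h3 h4
      exact Bandit.regretTail_bounds hσ π hθ hθ' h01 h0 h10 h2 hr hr2 h1 h3 h4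
    refine ⟨hall.mono fun T h => h.1, hall.mono fun T h => h.2.1, ?_⟩
    refine le_liminf_of_le (by isBoundedDefault) (hall.mono ?_)
    rintro T ⟨hE, hQ, hlog⟩
    rw [EReal.coe_le_coe_iff, le_div_iff₀ hE]
    linarith
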